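/- \textbf{Setting.} Labelled samples $z_1,z_2,\dots$ with $z_i=(x_i,y_i)\in\mathcal X\times\{0,1\}$ are i.i.d. with law $P$; $n\ge 1$ of them arrive at each time step $t\in\{1,\dots,T\}$, so that $N_t=nt$ are available after step $t$. The gain function $\ell$ on $\{0,1\}^2$ takes values in $\{-1,1\}$. The incumbent $f_I$ is a fixed measurable classifier of a projection $x_{\mathcal I}$ of the features. $\mathcal F_C$ is a class of measurable classifiers $\mathcal X\to\{0,1\}$ with finite VC-dimension $d$, satisfying the usual measurability condition that the suprema over $f\in\mathcal F_C$ of $|\sum_{i\le m} e_i\,\ell(f(x_i),y_i)|$ are measurable up to null sets, for all $m$ and all real weights $e_i$. Fix $\rho\in(0,1)$. For each $t$, a random set of (up to rounding) $(1-\rho)N_t$ of the first $N_t$ samples, drawn independently of the samples, is the training set, and the challenger $f_C^{(t)}\in\mathcal F_C$ maximizes over $\mathcal F_C$ the empirical gain on it (ERM). Its (random) gap is $G(t)=\mathbb E_{(X,Y)\sim P}[\ell(f_C^{(t)}(X),Y)]-\mathbb E_{(X,Y)\sim P}[\ell(f_I(X_{\mathcal I}),Y)]$, the expectations being over $(X,Y)$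 only; each $G(t)$ is assumed measurable. The horizon $T$ is finite, there is no discounting, each acquired sample costs $c\ge 0$ before as well as after the decision, training is free, and switching costs $c_s>0$ once. Put $$V_{\mathrm{switch}}(t)=-cnt-c_s+\sum_{t<\tau\le T}\bigl(nG(t)-cn\bigr),\qquad V_{\mathrm{discard}}(t)=-cnt,\qquad \Delta V(t)=V_{\mathrm{switch}}(t)-V_{\mathrm{discard}}(t).$$ The full-foresight oracle has value $V_{\textsc{oracle}}(T)=\max\{0,\max_{1\le t\le T}V_{\mathrm{switch}}(t)\}$. An algorithm \textsc{alg} (possibly randomized, and depending on $T$) decides at a random time $t_{\textsc{alg}}\in\{1,\dots,T\}$ either to switch to $f_C^{(t_{\textsc{alg}})}$ or to discard. Its value is $V_{\textsc{alg}}(T)=\sum_{t=1}^T\pi(t)$, where $\pi(t)=-cn$ for $t<t_{\textsc{alg}}$; $\pi(t_{\textsc{alg}})=-cn-c_s$ if it switches and $-cn$ if it discards; and, for $t>t_{\textsc{alg}}$, $\pi(t)=nG(t_{\textsc{alg}})-cn$ if it switched and $0$ if it discarded. Its regret is $R_{\textsc{alg}}(T)=\mathbb E[V_{\textsc{oracle}}(T)-V_{\textsc{alg}}(T)]$,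 over all sampling and algorithmic randomness. \textbf{Theorem.} Suppose that there are constants $w_1,w_2,w_3,w_4>0$ such that, for all sufficiently large $T$, the following two conditions hold together with probability at least $1-w_1/T$: (C1) $w_2T^{2/3}<t_{\textsc{alg}}<w_3T^{2/3}$; (C2) if $\Delta V(t_{\textsc{alg}})+w_4T^{2/3}\sqrt{\log T}<0$ then \textsc{alg} discards, and if $\Delta V(t_{\textsc{alg}})-w_4T^{2/3}\sqrt{\log T}>0$ then \textsc{alg} switches. Then $V_{\textsc{oracle}}(T)-V_{\textsc{alg}}(T)$ is integrable for every $T$, and $R_{\textsc{alg}}(T)=O\bigl(T^{2/3}\sqrt{\log T}\bigr)$ as $T\to\infty$. -/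

import Mathlib

open MeasureTheory ProbabilityTheory Filter Asymptotics Finset

noncomputable section

namespace ModelSwitch

/-! ## Economics: finite horizon `T`, no discounting, constant batch size, linear costs -/

/-- Economic parameters: `n` samples arrive at each time step; each acquired sample costs `c`
(the same before and after the decision, and training is free); deploying the challenger costs
`cs` once. -/
structure Economy where
  n : ℕ
  c : ℝ
  cs : ℝ
  n_pos : 0 < n
  c_nonneg : 0 ≤ c
  cs_pos : 0 < cs

/-- The number of full-feature samples available after time step `t`. -/
def Economy.N (E : Economy) (t : ℕ) : ℕ := E.n * t

/-- Pre-decision cost of a time step. -/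
def Economy.preCost (E : Economy) : ℝ := E.c * E.n

/-- Post-decision cost of a time step (paid only if the challenger was deployed). -/
def Economy.postCost (E : Economy) : ℝ := E.c * E.n

/-- Value of switching at time step `t` when the challenger trained at `t` has gap `G t`. -/
def Economy.vSwitch (E : Economy) (T : ℕ) (G : ℕ → ℝ) (t : ℕ) : ℝ :=
  -(∑ _τ ∈ Icc 1 t, E.preCost) - E.cs + ∑ _τ ∈ Ioc t T, ((E.n : ℝ) * G t - E.postCost)

/-- Value of discarding at time step `t`. -/
def Economy.vDiscard (E : Economy) (t : ℕ) : ℝ := -∑ _τ ∈ Icc 1 t, E.preCost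

/-- Incremental value of switching at time step `t`. -/
def Economy.deltaV (E : Economy) (T : ℕ) (G : ℕ → ℝ) (t : ℕ) : ℝ :=
  E.vSwitch T G t - E.vDiscard t

/-- Value of the full-foresight oracle: the best of discarding immediately (value `0`) and of
switching at some `t ∈ {1, …, T}`. -/
def Economy.oracleValue (E : Economy) (T : ℕ) (G : ℕ → ℝ) : ℝ :=
  (Icc 1 T).fold max 0 (E.vSwitch T G)

/-- The two irrevocable decisions. -/
inductive Decision where
  | switch
  | discard

/-- Value collected at time step `t` by an algorithm that takes decision `a` at time `s`. -/
def Economy.stepValue (E : Economy) (G : ℕ → ℝ) (s : ℕ) (a : Decision) (t : ℕ) : ℝ :=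
  if t < s then -E.preCost
  else if t = s then
    match a with
    | .switch => -E.preCost - E.cs
    | .discard => -E.preCost
  else
    match a with
    | .switch => (E.n : ℝ) * G s - E.postCost
    | .discard => 0

/-- Value over horizon `T` of an algorithm that takes decision `a` at time `s`. -/
def Economy.algValue (E : Economy) (T : ℕ) (G : ℕ → ℝ) (s : ℕ) (a : Decision) : ℝ :=
  ∑ t ∈ Icc 1 T, E.stepValue G s a t

/-! ## Statistics -/

/-- `s` is shattered by the class `F` of binary classifiers. -/
def Shatters {X : Type*} (F : Set (X → Bool)) (s : Finset X) : Prop :=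
  ∀ g : X → Bool, ∃ f ∈ F, ∀ x ∈ s, f x = g x

/-- The Vapnik–Chervonenkis dimension. -/
def vcDim {X : Type*} (F : Set (X → Bool)) : ℕ∞ :=
  ⨆ (s : Finset X) (_ : Shatters F s), (s.card : ℕ∞)

/-- The usual measurability condition on the class of gains `(x, y) ↦ ℓ (f x) y`, `f ∈ F`: the
classifiers are measurable, and the suprema over `F` of weighted empirical sums are measurable
(up to null sets) functions of the sample. -/
structure IsMeasurableClass {X : Type*} [MeasurableSpace X] (P : Measure (X × Bool))
    (ℓ : Bool → Bool → ℝ) (F : Set (X → Bool)) : Prop where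
  measurable : ∀ f ∈ F, Measurable f
  aemeasurable_iSup : ∀ (m : ℕ) (e : Fin m → ℝ),
    AEMeasurable (fun z : Fin m → X × Bool => ⨆ f : F, |∑ i, e i * ℓ (f.1 (z i).1) (z i).2|)
      (Measure.pi fun _ => P)

/-- The expected gap between a challenger `f`, which uses all features, and the incumbent `fI`,
which only sees the projection of the features. -/
def perfGap {X XI : Type*} [MeasurableSpace X] (P : Measure (X × Bool)) (ℓ : Bool → Bool → ℝ)
    (proj : X → XI) (fI : XI → Bool) (f : X → Bool) : ℝ :=
  ∫ z, ℓ (f z.1) z.2 ∂P - ∫ z, ℓ (fI (proj z.1)) z.2 ∂P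

/-- The training sets: at each time step `t`, a random set of (up to rounding) `(1 - ρ) N_t` of
the `N_t` samples with indices `0, …, N_t - 1`, drawn independently of the samples. -/
structure IsRandomSplit {Ω X : Type*} [MeasurableSpace Ω] [MeasurableSpace X] (μ : Measure Ω)
    (E : Economy) (ρ : ℝ) (Z : ℕ → Ω → X × Bool) (S : ℕ → Ω → Finset ℕ) : Prop where
  subset : ∀ t ω, S t ω ⊆ range (E.N t)
  card : ∀ t ω, |((S t ω).card : ℝ) - (1 - ρ) * E.N t| < 1
  measurable : ∀ t, Measurable (S t)
  indep : ∀ t, IndepFun (S t) (fun ω i => Z i ω) μ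

/-- `f t` is an empirical (gain) maximizer over `F` on the training set `S t`, for every `t`. -/
def IsERM {Ω X : Type*} (ℓ : Bool → Bool → ℝ) (F : Set (X → Bool)) (Z : ℕ → Ω → X × Bool)
    (S : ℕ → Ω → Finset ℕ) (f : ℕ → Ω → X → Bool) : Prop :=
  ∀ t ω, f t ω ∈ F ∧ ∀ g ∈ F,
    ∑ i ∈ S t ω, ℓ (g (Z i ω).1) (Z i ω).2 ≤ ∑ i ∈ S t ω, ℓ (f t ω (Z i ω).1) (Z i ω).2

/-- A (possibly randomized) algorithm, through its observable behaviour for every horizon `T`: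
the random time step `time T ∈ {1, …, T}` at which it decides, and its decision. No
non-anticipation condition is imposed, so that every algorithm is covered. -/
structure Algorithm (Ω : Type*) [MeasurableSpace Ω] where
  time : ℕ → Ω → ℕ
  decision : ℕ → Ω → Decision
  time_mem : ∀ T, 1 ≤ T → ∀ ω, time T ω ∈ Icc 1 T
  measurable_time : ∀ T, Measurable (time T)
  measurableSet_switch : ∀ T, MeasurableSet {ω | decision T ω = Decision.switch}

/-- The rate `T^{2/3} √(log T)`. -/
def rate (T : ℕ) : ℝ := (T : ℝ) ^ (2 / 3 : ℝ) * √(Real.log T)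

/-- The stopping time is of order `T^{2/3}`. -/
def CondStop {Ω : Type*} [MeasurableSpace Ω] (A : Algorithm Ω) (w₂ w₃ : ℝ) (T : ℕ) (ω : Ω) :
    Prop :=
  w₂ * (T : ℝ) ^ (2 / 3 : ℝ) < A.time T ω ∧ (A.time T ω : ℝ) < w₃ * (T : ℝ) ^ (2 / 3 : ℝ)

/-- The switching rule is consistent with the sign of `ΔV`, up to a slack. Here `G t ω` is the gap
of the challenger trained at time step `t`. -/
def CondRule {Ω : Type*} [MeasurableSpace Ω] (E : Economy) (G : ℕ → Ω → ℝ) (A : Algorithm Ω)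
    (w₄ : ℝ) (T : ℕ) (ω : Ω) : Prop :=
  (E.deltaV T (fun t => G t ω) (A.time T ω) + w₄ * rate T < 0 →
      A.decision T ω = Decision.discard) ∧
    (0 < E.deltaV T (fun t => G t ω) (A.time T ω) - w₄ * rate T →
      A.decision T ω = Decision.switch)

/-- Realized difference between the oracle's and the algorithm's value. -/
def valueLoss {Ω : Type*} [MeasurableSpace Ω] (E : Economy) (G : ℕ → Ω → ℝ) (A : Algorithm Ω)
    (T : ℕ) (ω : Ω) : ℝ :=
  E.oracleValue T (fun t => G t ω) -
    E.algValue T (fun t => G t ω) (A.time T ω) (A.decision T ω)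

/-- The regret. -/
def regret {Ω : Type*} [MeasurableSpace Ω] (μ : Measure Ω) (E : Economy) (G : ℕ → Ω → ℝ)
    (A : Algorithm Ω) (T : ℕ) : ℝ :=
  ∫ ω, valueLoss E G A T ω ∂μ

end ModelSwitch

end

/-!
The oracle is never worse than the algorithm, so the regret is nonnegative, and it remains to bound
it from above. Let `s` be the decision time. If no challenger beats the one trained at time `s` by
more than `η`, then even an oracle that switches at once and enjoys the gap `G s + η` during all `T`
steps gains at most `n T η + O(s)` over the better of the two decisions at time `s`, and condition
(C2) says that the decision taken is the better one up to `w₄ T^{2/3} √(log T)`. This is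
`Economy.oracleValue_sub_algValue_le_of_rule`. With `s = O(T^{2/3})` and
`η = O(T^{-1/3} √(log T))`, the loss is of the claimed order.

That `η` can be chosen of this size follows from uniform concentration. All the challengers lie in
`F`, so it suffices that the empirical maximizer at time `s` is within `η` of every member of `F`
(`expGain_le_of_erm`), which holds as soon as empirical and expected gains are uniformly
`η / 2`-close on the training set at time `s`. That training set has at least a constant times
`T^{2/3}` points, by (C1). The Vapnik–Chervonenkis inequality `measure_deviationSet_le` bounds the
probability of failure at a fixed time by `2 / T²`, and a union bound handles the times up to `T`,
whatever the dependence of the decision time on the samples. On the exceptional event, of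
probability `O(1 / T)`, the loss is at most linear in `T`, which contributes `O(1)`.

The Vapnik–Chervonenkis inequality is proved through exponential moments: Jensen's inequality with
respect to a ghost sample, invariance under the exchange of points between the two samples, the
Sauer–Shelah lemma, and `cosh x ≤ exp (x² / 2)`. The expected gain is integrated over the ghost
sample before the supremum over `F` is taken, so that only the measurability of suprema of weighted
empirical sums is needed. A training set that is random but independent of the samples is handled
by summing over its values (`measure_exists_deviation_le`).
-/

namespace ModelSwitch

/-! ### Growth function of a class of finite VC dimension -/

theorem Shatters.card_le_of_vcDim_eq {X : Type*} {F : Set (X → Bool)} {d : ℕ}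
    (hd : vcDim F = d) {s : Finset X} (hs : Shatters F s) : s.card ≤ d := by
  have h : (s.card : ℕ∞) ≤ vcDim F :=
    le_iSup₂ (f := fun (s : Finset X) (_ : Shatters F s) => (s.card : ℕ∞)) s hs
  rw [hd] at h
  exact_mod_cast h

theorem sum_choose_le_succ_pow (k d : ℕ) : ∑ j ∈ Iic d, k.choose j ≤ (k + 1) ^ d := by
  rw [add_pow, ← Nat.range_succ_eq_Iic]
  refine sum_le_sum fun j hj => ?_
  have hjd : j ≤ d := by simpa [Nat.lt_succ_iff] using hj
  calc k.choose j ≤ k ^ j := Nat.choose_le_pow k j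
    _ ≤ k ^ j * 1 ^ (d - j) * d.choose j := by
      simpa using Nat.le_mul_of_pos_right _ (Nat.choose_pos hjd)

/-- The Sauer–Shelah bound for classifiers evaluated at a family of points: up to agreement on
the family, the class has at most `(k + 1) ^ d` members. -/
theorem exists_finset_agree {X κ : Type*} [Fintype κ] {F : Set (X → Bool)} {d : ℕ}
    (hd : vcDim F = d) (x : κ → X) :
    ∃ R : Finset (X → Bool), (↑R ⊆ F) ∧ R.card ≤ (Fintype.card κ + 1) ^ d ∧
      ∀ f ∈ F, ∃ g ∈ R, ∀ i, g (x i) = f (x i) := by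
  classical
  let tr : (X → Bool) → Finset κ := fun f => univ.filter fun i => f (x i) = true
  let 𝒜 : Finset (Finset κ) := univ.filter fun a => ∃ f ∈ F, tr f = a
  have hA : ∀ a ∈ 𝒜, ∃ f ∈ F, tr f = a := fun a ha => (mem_filter.1 ha).2
  choose! φ hφF hφ using hA
  have hsh : ∀ s : Finset κ, 𝒜.Shatters s → s.card ≤ d := by
    intro s hs
    -- A repeated point cannot be separated from its copy, so `x` is injective on `s`.
    have hinj : Set.InjOn x s := by
      intro i hi j hj hij
      by_contra hne
      obtain ⟨a, ha, hsa⟩ := hs (singleton_subset_iff.2 hi)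
      obtain ⟨f, -, rfl⟩ := (mem_filter.1 ha).2
      have h1 : i ∈ s ∩ tr f := by rw [hsa]; simp
      have h2 : j ∉ s ∩ tr f := by rw [hsa]; simpa using Ne.symm hne
      have h1' : f (x i) = true := by simpa [tr, mem_coe.1 hi] using h1
      have h2' : ¬ f (x j) = true := by simpa [tr, mem_coe.1 hj] using h2
      exact h2' (hij ▸ h1')
    rw [← card_image_of_injOn hinj]
    refine Shatters.card_le_of_vcDim_eq hd fun g => ?_
    obtain ⟨a, ha, hsa⟩ := hs (filter_subset (fun i => g (x i) = true) s)
    obtain ⟨f, hf, rfl⟩ := (mem_filter.1 ha).2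
    refine ⟨f, hf, fun y hy => ?_⟩
    obtain ⟨i, hi, rfl⟩ := mem_image.1 hy
    have := Finset.ext_iff.1 hsa i
    simp only [tr, mem_inter, mem_filter, hi, mem_univ, true_and] at this
    exact Bool.eq_iff_iff.2 this
  have hcard : 𝒜.card ≤ (Fintype.card κ + 1) ^ d := by
    refine (card_le_card_shatterer 𝒜).trans (card_shatterer_le_sum_vcDim.trans ?_)
    refine le_trans ?_ (sum_choose_le_succ_pow _ d)
    refine sum_le_sum_of_subset (Iic_subset_Iic.2 ?_)
    exact Finset.sup_le fun s hs => hsh s (mem_shatterer.1 hs)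
  refine ⟨𝒜.image φ, ?_, card_image_le.trans hcard, fun f hf => ?_⟩
  · intro g hg
    obtain ⟨a, ha, rfl⟩ := mem_image.1 (mem_coe.1 hg)
    exact hφF a ha
  · have ha : tr f ∈ 𝒜 := mem_filter.2 ⟨mem_univ _, f, hf, rfl⟩
    refine ⟨φ (tr f), mem_image_of_mem _ ha, fun i => ?_⟩
    have := Finset.ext_iff.1 (hφ _ ha) i
    simp only [tr, mem_filter, mem_univ, true_and] at this
    exact Bool.eq_iff_iff.2 this

/-! ### Exponential moments of Rademacher sums -/

/-- The sign `±1` encoded by a Boolean. -/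
noncomputable def sgn (b : Bool) : ℝ := if b then 1 else -1

theorem sum_exp_sgn_le {ι : Type*} [Fintype ι] [DecidableEq ι] (b : ι → ℝ)
    (hb : ∀ i, |b i| ≤ 2) (r : ℝ) :
    ∑ σ : ι → Bool, Real.exp (r * ∑ i, sgn (σ i) * b i) ≤
      2 ^ Fintype.card ι * Real.exp (2 * r ^ 2 * Fintype.card ι) := by
  have h1 : ∑ σ : ι → Bool, Real.exp (r * ∑ i, sgn (σ i) * b i) =
      ∏ i, ∑ s : Bool, Real.exp (r * (sgn s * b i)) := by
    rw [prod_univ_sum]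
    simp only [Fintype.piFinset_univ]
    refine sum_congr rfl fun σ _ => ?_
    rw [mul_sum, Real.exp_sum]
  have h2 : ∀ i, ∑ s : Bool, Real.exp (r * (sgn s * b i)) ≤ 2 * Real.exp (2 * r ^ 2) := by
    intro i
    have hcosh : ∑ s : Bool, Real.exp (r * (sgn s * b i)) = 2 * Real.cosh (r * b i) := by
      rw [Real.cosh_eq]
      simp [sgn]
      ring
    rw [hcosh]
    refine mul_le_mul_of_nonneg_left ((Real.cosh_le_exp_half_sq _).trans ?_) zero_le_two
    refine Real.exp_le_exp.2 ?_
    have : b i ^ 2 ≤ 4 := by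
      have := sq_le_sq' (by linarith [abs_nonneg (b i), hb i]) (hb i)
      rw [sq_abs] at this
      linarith
    nlinarith [sq_nonneg r]
  rw [h1]
  calc ∏ i, ∑ s : Bool, Real.exp (r * (sgn s * b i)) ≤ ∏ _i : ι, 2 * Real.exp (2 * r ^ 2) :=
        prod_le_prod (fun i _ => sum_nonneg fun s _ => (Real.exp_pos _).le) fun i _ => h2 i
    _ = _ := by
      rw [prod_const, mul_pow, ← Real.exp_nat_mul, card_univ]
      ring_nf

theorem sum_exp_abs_sgn_le {ι : Type*} [Fintype ι] [DecidableEq ι] (b : ι → ℝ)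
    (hb : ∀ i, |b i| ≤ 2) (r : ℝ) :
    ∑ σ : ι → Bool, Real.exp (r * |∑ i, sgn (σ i) * b i|) ≤
      2 * (2 ^ Fintype.card ι * Real.exp (2 * r ^ 2 * Fintype.card ι)) := by
  have h : ∀ v : ℝ, Real.exp (r * |v|) ≤ Real.exp (r * v) + Real.exp (-r * v) := by
    intro v
    rcases abs_cases v with ⟨h, -⟩ | ⟨h, -⟩ <;> rw [h]
    · linarith [Real.exp_pos (-r * v)]
    · rw [mul_neg, ← neg_mul]
      linarith [Real.exp_pos (r * v)]
  refine (sum_le_sum fun σ _ => h _).trans ?_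
  rw [sum_add_distrib, two_mul]
  refine add_le_add (sum_exp_sgn_le b hb r) ?_
  simpa using sum_exp_sgn_le b hb (-r)

/-! ### The symmetrized process -/

/-- The supremum over the class `F` of the absolute weighted empirical gains. -/
noncomputable def supGain {X ι : Type*} [Fintype ι] (ℓ : Bool → Bool → ℝ) (F : Set (X → Bool))
    (e : ι → ℝ) (z : ι → X × Bool) : ℝ :=
  ⨆ f : F, |∑ i, e i * ℓ (f.1 (z i).1) (z i).2|

/-- The supremum over the class `F` of the absolute signed differences of the gains on a sample
and on a ghost sample. -/
noncomputable def supDiff {X ι : Type*} [Fintype ι] (ℓ : Bool → Bool → ℝ) (F : Set (X → Bool))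
    (σ : ι → Bool) (p : (ι → X × Bool) × (ι → X × Bool)) : ℝ :=
  ⨆ f : F, |∑ i, sgn (σ i) * (ℓ (f.1 (p.1 i).1) (p.1 i).2 - ℓ (f.1 (p.2 i).1) (p.2 i).2)|

section

variable {X : Type*} {ι : Type*} [Fintype ι] {ℓ : Bool → Bool → ℝ} {F : Set (X → Bool)}

theorem abs_gain_eq_one (hℓ : ∀ a b, ℓ a b = -1 ∨ ℓ a b = 1) (a b : Bool) : |ℓ a b| = 1 := by
  rcases hℓ a b with h | h <;> simp [h]

theorem abs_gain_sub_le (hℓ : ∀ a b, ℓ a b = -1 ∨ ℓ a b = 1) (a b a' b' : Bool) :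
    |ℓ a b - ℓ a' b'| ≤ 2 := by
  refine (abs_sub _ _).trans ?_
  rw [abs_gain_eq_one hℓ, abs_gain_eq_one hℓ]
  norm_num

theorem abs_signed_sum_le (hℓ : ∀ a b, ℓ a b = -1 ∨ ℓ a b = 1) (σ : ι → Bool)
    (p : (ι → X × Bool) × (ι → X × Bool)) (f : X → Bool) :
    |∑ i, sgn (σ i) * (ℓ (f (p.1 i).1) (p.1 i).2 - ℓ (f (p.2 i).1) (p.2 i).2)| ≤
      2 * Fintype.card ι := by
  refine (abs_sum_le_sum_abs _ _).trans ?_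
  calc _ ≤ ∑ _i : ι, (2 : ℝ) := by
        refine sum_le_sum fun i _ => ?_
        have h1 : |sgn (σ i)| = 1 := by cases h : σ i <;> simp [sgn]
        rw [abs_mul, h1, one_mul]
        exact abs_gain_sub_le hℓ _ _ _ _
    _ = 2 * Fintype.card ι := by simp [mul_comm]

theorem le_supDiff (hℓ : ∀ a b, ℓ a b = -1 ∨ ℓ a b = 1) (σ : ι → Bool)
    (p : (ι → X × Bool) × (ι → X × Bool)) {f : X → Bool} (hf : f ∈ F) :
    |∑ i, sgn (σ i) * (ℓ (f (p.1 i).1) (p.1 i).2 - ℓ (f (p.2 i).1) (p.2 i).2)| ≤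
      supDiff ℓ F σ p :=
  le_ciSup (f := fun f : F => |∑ i, sgn (σ i) *
    (ℓ (f.1 (p.1 i).1) (p.1 i).2 - ℓ (f.1 (p.2 i).1) (p.2 i).2)|)
    ⟨2 * Fintype.card ι, by rintro _ ⟨g, rfl⟩; exact abs_signed_sum_le hℓ σ p g.1⟩ ⟨f, hf⟩

/-- Averaging over the signs: on the points of the two samples only polynomially many classifiers
differ, and each of them contributes a Rademacher sum. -/
theorem sum_exp_supDiff_le [DecidableEq ι] (hℓ : ∀ a b, ℓ a b = -1 ∨ ℓ a b = 1)
    (hne : F.Nonempty) {d : ℕ} (hd : vcDim F = d) {r : ℝ} (hr : 0 ≤ r)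
    (p : (ι → X × Bool) × (ι → X × Bool)) :
    ∑ σ : ι → Bool, Real.exp (r * supDiff ℓ F σ p) ≤
      2 ^ Fintype.card ι * (2 * (2 * Fintype.card ι + 1) ^ d *
        Real.exp (2 * r ^ 2 * Fintype.card ι)) := by
  obtain ⟨R, hRF, hRc, hR⟩ := exists_finset_agree hd
    (Sum.elim (fun i => (p.1 i).1) (fun i => (p.2 i).1))
  let v : (ι → Bool) → (X → Bool) → ℝ := fun σ f =>
    |∑ i, sgn (σ i) * (ℓ (f (p.1 i).1) (p.1 i).2 - ℓ (f (p.2 i).1) (p.2 i).2)|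
  have hv : ∀ σ, ∀ f ∈ F, ∃ g ∈ R, v σ g = v σ f := by
    intro σ f hf
    obtain ⟨g, hg, hgf⟩ := hR f hf
    refine ⟨g, hg, ?_⟩
    have h1 : ∀ i, g (p.1 i).1 = f (p.1 i).1 := fun i => hgf (Sum.inl i)
    have h2 : ∀ i, g (p.2 i).1 = f (p.2 i).1 := fun i => hgf (Sum.inr i)
    simp only [v, h1, h2]
  have hRne : R.Nonempty := by
    obtain ⟨f, hf⟩ := hne
    obtain ⟨g, hg, -⟩ := hR f hf
    exact ⟨g, hg⟩
  have hsup : ∀ σ, Real.exp (r * supDiff ℓ F σ p) ≤ ∑ g ∈ R, Real.exp (r * v σ g) := by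
    intro σ
    obtain ⟨g₀, hg₀, hmax⟩ := R.exists_max_image (v σ) hRne
    have hle : supDiff ℓ F σ p ≤ v σ g₀ := by
      have : Nonempty F := hne.to_subtype
      refine ciSup_le fun f => ?_
      obtain ⟨g, hg, hgf⟩ := hv σ f.1 f.2
      exact hgf.symm.le.trans (hmax g hg)
    calc Real.exp (r * supDiff ℓ F σ p) ≤ Real.exp (r * v σ g₀) :=
          Real.exp_le_exp.2 (mul_le_mul_of_nonneg_left hle hr)
      _ ≤ _ := single_le_sum (f := fun g => Real.exp (r * v σ g))
          (fun g _ => (Real.exp_pos _).le) hg₀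
  calc ∑ σ : ι → Bool, Real.exp (r * supDiff ℓ F σ p)
      ≤ ∑ σ : ι → Bool, ∑ g ∈ R, Real.exp (r * v σ g) := sum_le_sum fun σ _ => hsup σ
    _ = ∑ g ∈ R, ∑ σ : ι → Bool, Real.exp (r * v σ g) := sum_comm
    _ ≤ ∑ _g ∈ R, 2 * (2 ^ Fintype.card ι * Real.exp (2 * r ^ 2 * Fintype.card ι)) :=
        sum_le_sum fun g _ => sum_exp_abs_sgn_le _ (fun i => abs_gain_sub_le hℓ _ _ _ _) r
    _ = R.card * (2 * (2 ^ Fintype.card ι * Real.exp (2 * r ^ 2 * Fintype.card ι))) := by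
        rw [sum_const, nsmul_eq_mul]
    _ ≤ ((2 * Fintype.card ι + 1 : ℝ) ^ d) *
          (2 * (2 ^ Fintype.card ι * Real.exp (2 * r ^ 2 * Fintype.card ι))) := by
        refine mul_le_mul_of_nonneg_right ?_ (by positivity)
        have : (R.card : ℝ) ≤ ((Fintype.card (ι ⊕ ι) + 1 : ℕ) : ℝ) ^ d := by exact_mod_cast hRc
        refine this.trans_eq ?_
        rw [Fintype.card_sum]
        push_cast
        ring
    _ = _ := by ring

/-- Exchanging the `i`-th points of the sample and of the ghost sample whenever `σ i = false`. -/
def exchange {X ι : Type*} (σ : ι → Bool) (p : (ι → X) × (ι → X)) : (ι → X) × (ι → X) :=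
  (fun i => if σ i then p.1 i else p.2 i, fun i => if σ i then p.2 i else p.1 i)

theorem supDiff_exchange (σ : ι → Bool) (p : (ι → X × Bool) × (ι → X × Bool)) :
    supDiff ℓ F (fun _ => true) (exchange σ p) = supDiff ℓ F σ p := by
  simp only [supDiff]
  refine iSup_congr fun f => ?_
  congr 1
  refine sum_congr rfl fun i _ => ?_
  cases h : σ i <;> simp [exchange, sgn, h]

end

section

variable {X : Type*} [MeasurableSpace X] {ι : Type*} [Fintype ι] {ℓ : Bool → Bool → ℝ}
  {F : Set (X → Bool)} {P : Measure (X × Bool)} [IsProbabilityMeasure P]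

theorem IsMeasurableClass.aemeasurable_supGain (hF : IsMeasurableClass P ℓ F) (e : ι → ℝ) :
    AEMeasurable (supGain ℓ F e) (Measure.pi fun _ : ι => P) := by
  let k := Fintype.equivFin ι
  have hmp := measurePreserving_piCongrLeft (fun _ : Fin (Fintype.card ι) => P) k
  have h := (hF.aemeasurable_iSup _ (fun j => e (k.symm j))).comp_quasiMeasurePreserving
    hmp.quasiMeasurePreserving
  convert h using 1
  funext z
  simp only [supGain, Function.comp_apply]
  refine iSup_congr fun f => ?_
  rw [← k.symm.sum_comp]
  congr 1
  refine sum_congr rfl fun j _ => ?_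
  have : (MeasurableEquiv.piCongrLeft (fun _ : Fin (Fintype.card ι) => X × Bool) k) z j =
      z (k.symm j) := by
    obtain ⟨i, rfl⟩ := k.surjective j
    rw [MeasurableEquiv.coe_piCongrLeft, Equiv.piCongrLeft_apply_apply, k.symm_apply_apply]
  rw [this]

theorem IsMeasurableClass.aemeasurable_supDiff (hF : IsMeasurableClass P ℓ F) (σ : ι → Bool) :
    AEMeasurable (supDiff ℓ F σ)
      ((Measure.pi fun _ : ι => P).prod (Measure.pi fun _ : ι => P)) := by
  have hmp := measurePreserving_sumPiEquivProdPi_symm (fun _ : ι ⊕ ι => P)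
  have h := (hF.aemeasurable_supGain
    (Sum.elim (fun i => sgn (σ i)) (fun i => -sgn (σ i)))).comp_quasiMeasurePreserving
    hmp.quasiMeasurePreserving
  convert h using 1
  funext p
  simp only [supGain, supDiff, Function.comp_apply]
  refine iSup_congr fun f => ?_
  rw [Fintype.sum_sum_type, ← sum_add_distrib]
  congr 1
  refine sum_congr rfl fun i _ => ?_
  simp only [Sum.elim_inl, Sum.elim_inr]
  change _ = sgn (σ i) * ℓ (f.1 (p.1 i).1) (p.1 i).2 + -sgn (σ i) * ℓ (f.1 (p.2 i).1) (p.2 i).2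
  ring

theorem measurePreserving_exchange {Y : Type*} [MeasurableSpace Y] (Q : Measure Y)
    [IsProbabilityMeasure Q] (σ : ι → Bool) :
    MeasurePreserving (exchange σ)
      ((Measure.pi fun _ : ι => Q).prod (Measure.pi fun _ : ι => Q))
      ((Measure.pi fun _ : ι => Q).prod (Measure.pi fun _ : ι => Q)) := by
  have h1 := measurePreserving_arrowProdEquivProdArrow Y Y ι (fun _ => Q) (fun _ => Q)
  have h2 : MeasurePreserving (fun (a : ι → Y × Y) i => (if σ i then id else Prod.swap) (a i))
      (Measure.pi fun _ : ι => Q.prod Q) (Measure.pi fun _ : ι => Q.prod Q) := by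
    refine measurePreserving_pi (fun _ => Q.prod Q) (fun _ => Q.prod Q) fun i => ?_
    split_ifs
    · exact MeasurePreserving.id _
    · exact Measure.measurePreserving_swap
  have h3 := h1.comp (h2.comp (h1.symm _))
  convert h3 using 1
  funext p
  refine Prod.ext ?_ ?_ <;> funext i <;>
    simp only [exchange, Function.comp_apply] <;>
    cases h : σ i <;> simp [MeasurableEquiv.arrowProdEquivProdArrow, Equiv.arrowProdEquivProdArrow, h]

/-- Symmetrization: the exponential moment of the supremum of the differences between a sample
and a ghost sample. -/
theorem lintegral_exp_supDiff_le (hF : IsMeasurableClass P ℓ F)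
    (hℓ : ∀ a b, ℓ a b = -1 ∨ ℓ a b = 1) (hne : F.Nonempty) {d : ℕ} (hd : vcDim F = d)
    {r : ℝ} (hr : 0 ≤ r) :
    ∫⁻ p, ENNReal.ofReal (Real.exp (r * supDiff ℓ F (fun _ : ι => true) p))
        ∂((Measure.pi fun _ : ι => P).prod (Measure.pi fun _ : ι => P)) ≤
      ENNReal.ofReal (2 * (2 * Fintype.card ι + 1) ^ d *
        Real.exp (2 * r ^ 2 * Fintype.card ι)) := by
  classical
  set Q := (Measure.pi fun _ : ι => P).prod (Measure.pi fun _ : ι => P)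
  set B := 2 * (2 * Fintype.card ι + 1 : ℝ) ^ d * Real.exp (2 * r ^ 2 * Fintype.card ι)
  let g : (ι → Bool) → (ι → X × Bool) × (ι → X × Bool) → ENNReal := fun σ p =>
    ENNReal.ofReal (Real.exp (r * supDiff ℓ F σ p))
  have hg : ∀ σ, AEMeasurable (g σ) Q := fun σ =>
    (Real.measurable_exp.comp_aemeasurable
      ((hF.aemeasurable_supDiff σ).const_mul r)).ennreal_ofReal
  have hinv : ∀ σ, ∫⁻ p, g σ p ∂Q = ∫⁻ p, g (fun _ => true) p ∂Q := by
    intro σ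
    have hmp := measurePreserving_exchange (ι := ι) P σ
    have h := lintegral_map' (f := g fun _ => true) (g := exchange σ) (μ := Q)
      (by rw [hmp.map_eq]; exact hg _) hmp.measurable.aemeasurable
    rw [hmp.map_eq] at h
    rw [h]
    refine lintegral_congr fun p => ?_
    simp only [g, supDiff_exchange]
  have hsum : ∑ σ : ι → Bool, ∫⁻ p, g σ p ∂Q ≤ 2 ^ Fintype.card ι * ENNReal.ofReal B := by
    rw [← lintegral_finsetSum' _ fun σ _ => hg σ]
    calc ∫⁻ p, ∑ σ : ι → Bool, g σ p ∂Q
        ≤ ∫⁻ _p, ENNReal.ofReal (2 ^ Fintype.card ι * B) ∂Q := by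
          refine lintegral_mono fun p => ?_
          rw [← ENNReal.ofReal_sum_of_nonneg fun σ _ => (Real.exp_pos _).le]
          exact ENNReal.ofReal_le_ofReal (sum_exp_supDiff_le hℓ hne hd hr p)
      _ = 2 ^ Fintype.card ι * ENNReal.ofReal B := by
          rw [lintegral_const, measure_univ, mul_one, ENNReal.ofReal_mul (by positivity),
            ENNReal.ofReal_pow zero_le_two]
          simp
  simp only [hinv, sum_const, card_univ, Fintype.card_fun, Fintype.card_bool, nsmul_eq_mul] at hsum
  push_cast at hsum
  exact (ENNReal.mul_le_mul_iff_right (by simp) (by simp)).1 hsum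

end

/-! ### Uniform concentration over the class -/

/-- The expected gain of the classifier `f`. -/
noncomputable def expGain {X : Type*} [MeasurableSpace X] (P : Measure (X × Bool))
    (ℓ : Bool → Bool → ℝ) (f : X → Bool) : ℝ :=
  ∫ z, ℓ (f z.1) z.2 ∂P

section

variable {X : Type*} [MeasurableSpace X] {ι : Type*} [Fintype ι] {ℓ : Bool → Bool → ℝ}
  {F : Set (X → Bool)} {P : Measure (X × Bool)} [IsProbabilityMeasure P]

theorem measurable_gain (ℓ : Bool → Bool → ℝ) {f : X → Bool} (hf : Measurable f) :
    Measurable fun z : X × Bool => ℓ (f z.1) z.2 :=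
  (measurable_of_countable (fun q : Bool × Bool => ℓ q.1 q.2)).comp
    ((hf.comp measurable_fst).prodMk measurable_snd)

/-- Jensen's inequality with respect to the ghost sample. -/
theorem exp_abs_sum_sub_le_lintegral (hℓ : ∀ a b, ℓ a b = -1 ∨ ℓ a b = 1) {f : X → Bool}
    (hfm : Measurable f) (hf : f ∈ F) {r : ℝ} (hr : 0 ≤ r) (z : ι → X × Bool) :
    ENNReal.ofReal (Real.exp (r * |∑ i, ℓ (f (z i).1) (z i).2 -
        Fintype.card ι * expGain P ℓ f|)) ≤
      ∫⁻ z', ENNReal.ofReal (Real.exp (r * supDiff ℓ F (fun _ => true) (z, z')))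
        ∂(Measure.pi fun _ : ι => P) := by
  set Q := Measure.pi fun _ : ι => P
  let D : (ι → X × Bool) → ℝ := fun z' =>
    ∑ i, (ℓ (f (z i).1) (z i).2 - ℓ (f (z' i).1) (z' i).2)
  have hterm : ∀ i, Integrable (fun z' : ι → X × Bool => ℓ (f (z' i).1) (z' i).2) Q := by
    intro i
    refine Integrable.of_bound
      ((measurable_gain ℓ hfm).comp (measurable_pi_apply i)).aestronglyMeasurable 1 ?_
    exact Eventually.of_forall fun z' => (abs_gain_eq_one hℓ _ _).le
  have hmean : ∀ i, ∫ z', ℓ (f (z' i).1) (z' i).2 ∂Q = expGain P ℓ f := by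
    intro i
    have hmp := measurePreserving_eval (fun _ : ι => P) i
    have h := integral_map (μ := Q) (φ := Function.eval i) hmp.measurable.aemeasurable
      (f := fun w : X × Bool => ℓ (f w.1) w.2) (measurable_gain ℓ hfm).aestronglyMeasurable
    rw [hmp.map_eq] at h
    exact h.symm
  have hsub : ∀ i, Integrable
      (fun z' : ι → X × Bool => ℓ (f (z i).1) (z i).2 - ℓ (f (z' i).1) (z' i).2) Q :=
    fun i => (integrable_const _).sub (hterm i)
  have hDint : Integrable D Q := integrable_finsetSum _ fun i _ => hsub i
  have hDmean : ∫ z', D z' ∂Q =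
      ∑ i, ℓ (f (z i).1) (z i).2 - Fintype.card ι * expGain P ℓ f := by
    rw [integral_finsetSum _ fun i _ => hsub i]
    simp_rw [integral_sub (integrable_const _) (hterm _), hmean]
    simp
  have hDm : Measurable D := Finset.measurable_sum _ fun i _ =>
    measurable_const.sub ((measurable_gain ℓ hfm).comp (measurable_pi_apply i))
  have hDb : ∀ z', |D z'| ≤ supDiff ℓ F (fun _ => true) (z, z') := by
    intro z'
    simpa [D, sgn] using le_supDiff hℓ (fun _ => true) (z, z') hf
  have hDc : ∀ z', |D z'| ≤ 2 * Fintype.card ι := by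
    intro z'
    simpa [D, sgn] using abs_signed_sum_le hℓ (fun _ => true) (z, z') f
  have hexp : Integrable (fun z' => Real.exp (r * |D z'|)) Q := by
    refine Integrable.of_bound
      (Real.measurable_exp.comp (hDm.abs.const_mul r)).aestronglyMeasurable
      (Real.exp (r * (2 * Fintype.card ι))) (Eventually.of_forall fun z' => ?_)
    rw [Real.norm_eq_abs, Real.abs_exp]
    exact Real.exp_le_exp.2 (mul_le_mul_of_nonneg_left (hDc z') hr)
  have hjensen : Real.exp (r * |∫ z', D z' ∂Q|) ≤ ∫ z', Real.exp (r * |D z'|) ∂Q := by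
    refine le_trans (Real.exp_le_exp.2
      (mul_le_mul_of_nonneg_left (abs_integral_le_integral_abs) hr)) ?_
    rw [← integral_const_mul]
    exact convexOn_exp.map_integral_le Real.continuous_exp.continuousOn isClosed_univ
      (Eventually.of_forall fun _ => Set.mem_univ _) (hDint.abs.const_mul r) hexp
  rw [← hDmean]
  refine (ENNReal.ofReal_le_ofReal hjensen).trans ?_
  rw [ofReal_integral_eq_lintegral_ofReal hexp
    (Eventually.of_forall fun _ => (Real.exp_pos _).le)]
  refine lintegral_mono fun z' => ENNReal.ofReal_le_ofReal (Real.exp_le_exp.2 ?_)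
  exact mul_le_mul_of_nonneg_left (hDb z') hr

/-- The samples on which some classifier of `F` has an empirical gain at distance at least `ε`
from its expected gain. -/
def deviationSet (P : Measure (X × Bool)) (ℓ : Bool → Bool → ℝ) (F : Set (X → Bool)) (ι : Type*)
    [Fintype ι] (ε : ℝ) : Set (ι → X × Bool) :=
  {z | ∃ f ∈ F, Fintype.card ι * ε ≤
    |∑ i, ℓ (f (z i).1) (z i).2 - Fintype.card ι * expGain P ℓ f|}

/-- The Vapnik–Chervonenkis inequality. -/
theorem measure_deviationSet_le (hF : IsMeasurableClass P ℓ F)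
    (hℓ : ∀ a b, ℓ a b = -1 ∨ ℓ a b = 1) (hne : F.Nonempty) {d : ℕ} (hd : vcDim F = d)
    {ε : ℝ} (hε : 0 ≤ ε) :
    (Measure.pi fun _ : ι => P) (deviationSet P ℓ F ι ε) ≤
      ENNReal.ofReal (2 * (2 * Fintype.card ι + 1) ^ d *
        Real.exp (-(Fintype.card ι * ε ^ 2 / 8))) := by
  set Q := Measure.pi fun _ : ι => P
  set m : ℝ := (Fintype.card ι : ℝ)
  -- The parameter `ε / 4` optimizes the Chernoff bound.
  have hr : 0 ≤ ε / 4 := by positivity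
  let g : (ι → X × Bool) × (ι → X × Bool) → ENNReal := fun p =>
    ENNReal.ofReal (Real.exp (ε / 4 * supDiff ℓ F (fun _ => true) p))
  have hg : AEMeasurable g (Q.prod Q) := (Real.measurable_exp.comp_aemeasurable
    ((hF.aemeasurable_supDiff _).const_mul _)).ennreal_ofReal
  set c := ENNReal.ofReal (Real.exp (ε / 4 * (m * ε))) with hc
  have hsub : deviationSet P ℓ F ι ε ⊆ {z | c ≤ ∫⁻ z', g (z, z') ∂Q} := by
    rintro z ⟨f, hf, hz⟩
    refine le_trans (ENNReal.ofReal_le_ofReal (Real.exp_le_exp.2 ?_))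
      (exp_abs_sum_sub_le_lintegral hℓ (hF.measurable f hf) hf hr z)
    exact mul_le_mul_of_nonneg_left hz hr
  have hmarkov := mul_meas_ge_le_lintegral₀ hg.lintegral_prod_right' c
  rw [← lintegral_prod _ hg] at hmarkov
  have hbound := hmarkov.trans (lintegral_exp_supDiff_le hF hℓ hne hd hr)
  have hc0 : c ≠ 0 := by simp [hc, Real.exp_pos]
  refine (measure_mono hsub).trans ?_
  rw [← ENNReal.mul_le_mul_iff_right hc0 ENNReal.ofReal_ne_top]
  refine hbound.trans_eq ?_
  rw [hc, ← ENNReal.ofReal_mul (Real.exp_pos _).le]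
  congr 1
  rw [mul_left_comm, ← Real.exp_add]
  congr 2
  ring

end

/-! ### Random training sets and empirical maximizers -/

section

variable {Ω X : Type*} [MeasurableSpace Ω] [MeasurableSpace X] {μ : Measure Ω}
  [IsProbabilityMeasure μ] {ℓ : Bool → Bool → ℝ} {F : Set (X → Bool)} {P : Measure (X × Bool)}
  [IsProbabilityMeasure P] {Z : ℕ → Ω → X × Bool}

/-- Conditionally on the training set, which is independent of the sample, the training data are
i.i.d., so that the concentration inequality holds on a random training set. -/
theorem measure_exists_deviation_le (hF : IsMeasurableClass P ℓ F)
    (hℓ : ∀ a b, ℓ a b = -1 ∨ ℓ a b = 1) (hne : F.Nonempty) {d : ℕ} (hd : vcDim F = d)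
    (hZm : ∀ i, Measurable (Z i)) (hZi : iIndepFun Z μ) (hZP : ∀ i, μ.map (Z i) = P)
    {S : Ω → Finset ℕ} (hSm : Measurable S) (hSi : IndepFun S (fun ω i => Z i ω) μ) {N : ℕ}
    (hSN : ∀ ω, S ω ⊆ range N) {m₀ : ℝ} (hm₀ : ∀ ω, m₀ ≤ (S ω).card) {ε : ℝ} (hε : 0 ≤ ε) :
    μ {ω | ∃ f ∈ F, (S ω).card * ε ≤
        |∑ i ∈ S ω, ℓ (f (Z i ω).1) (Z i ω).2 - (S ω).card * expGain P ℓ f|} ≤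
      ENNReal.ofReal (2 * (2 * N + 1) ^ d * Real.exp (-(m₀ * ε ^ 2 / 8))) := by
  set δ := ENNReal.ofReal (2 * (2 * N + 1) ^ d * Real.exp (-(m₀ * ε ^ 2 / 8)))
  let J : Finset (Finset ℕ) := (range N).powerset.filter fun s => m₀ ≤ s.card
  let B : (s : Finset ℕ) → Set (s → X × Bool) := fun s =>
    toMeasurable (Measure.pi fun _ : s => P) (deviationSet P ℓ F s ε)
  let C : Finset ℕ → Set Ω := fun s => {ω | (fun i : s => Z i ω) ∈ B s}
  have hCle : ∀ s ∈ J, μ (C s) ≤ δ := by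
    intro s hs
    obtain ⟨hsN, hsm⟩ := mem_filter.1 hs
    have hcard : s.card ≤ N := by simpa using card_le_card (mem_powerset.1 hsN)
    have hlaw : μ.map (fun ω (i : s) => Z i ω) = Measure.pi fun _ : s => P := by
      have h := (iIndepFun_iff_map_fun_eq_pi_map
        (f := fun (i : s) => Z i) fun i => (hZm i).aemeasurable).1
        (hZi.precomp Subtype.val_injective)
      simpa only [hZP] using h
    have hmeas : Measurable fun ω (i : s) => Z i ω := measurable_pi_lambda _ fun i => hZm i
    have h1 : μ (C s) = (Measure.pi fun _ : s => P) (B s) := by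
      rw [← hlaw, Measure.map_apply hmeas (measurableSet_toMeasurable _ _)]
      rfl
    rw [h1, measure_toMeasurable]
    refine (measure_deviationSet_le hF hℓ hne hd hε).trans (ENNReal.ofReal_le_ofReal ?_)
    rw [Fintype.card_coe]
    have : (s.card : ℝ) ≤ N := by exact_mod_cast hcard
    gcongr
  have hind : ∀ s, μ ({ω | S ω = s} ∩ C s) = μ {ω | S ω = s} * μ (C s) := by
    intro s
    have hmeas : Measurable fun (z : ℕ → X × Bool) (i : s) => z i :=
      measurable_pi_lambda _ fun i => measurable_pi_apply _
    exact hSi.measure_inter_preimage_eq_mul {s} _ (measurableSet_singleton s)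
      (hmeas (measurableSet_toMeasurable (Measure.pi fun _ : s => P) (deviationSet P ℓ F s ε)))
  have hcover : {ω | ∃ f ∈ F, (S ω).card * ε ≤
        |∑ i ∈ S ω, ℓ (f (Z i ω).1) (Z i ω).2 - (S ω).card * expGain P ℓ f|} ⊆
      ⋃ s ∈ J, {ω | S ω = s} ∩ C s := by
    rintro ω ⟨f, hf, h⟩
    refine Set.mem_biUnion (x := S ω)
      (mem_coe.2 (mem_filter.2 ⟨mem_powerset.2 (hSN ω), hm₀ ω⟩)) ⟨rfl, ?_⟩
    refine subset_toMeasurable _ _ ⟨f, hf, ?_⟩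
    rw [Fintype.card_coe, sum_coe_sort (S ω) fun i => ℓ (f (Z i ω).1) (Z i ω).2]
    exact h
  calc _ ≤ μ (⋃ s ∈ J, {ω | S ω = s} ∩ C s) := measure_mono hcover
    _ ≤ ∑ s ∈ J, μ ({ω | S ω = s} ∩ C s) := measure_biUnion_finset_le _ _
    _ ≤ ∑ s ∈ J, μ {ω | S ω = s} * δ := by
        refine sum_le_sum fun s hs => ?_
        rw [hind s]
        gcongr
        exact hCle s hs
    _ = μ (⋃ s ∈ J, {ω | S ω = s}) * δ := by
        rw [← sum_mul, measure_biUnion_finset]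
        · intro s _ s' _ hss
          exact Set.disjoint_left.2 fun ω h h' => hss (h.symm.trans h')
        · exact fun s _ => hSm (measurableSet_singleton s)
    _ ≤ 1 * δ := by gcongr; exact prob_le_one
    _ = δ := one_mul δ

omit [IsProbabilityMeasure μ] [MeasurableSpace Ω] [IsProbabilityMeasure P] in
/-- An empirical maximizer is nearly optimal wherever empirical and expected gains are uniformly
close. -/
theorem expGain_le_of_erm {S : Finset ℕ} {z : ℕ → X × Bool} {f g : X → Bool} {ε : ℝ}
    (hS : 0 < S.card)
    (hdev : ∀ h ∈ F, |∑ i ∈ S, ℓ (h (z i).1) (z i).2 - S.card * expGain P ℓ h| < S.card * ε)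
    (hf : f ∈ F) (hg : g ∈ F)
    (hfg : ∑ i ∈ S, ℓ (g (z i).1) (z i).2 ≤ ∑ i ∈ S, ℓ (f (z i).1) (z i).2) :
    expGain P ℓ g ≤ expGain P ℓ f + 2 * ε := by
  have h1 := (abs_lt.1 (hdev f hf)).2
  have h2 := (abs_lt.1 (hdev g hg)).1
  have hS' : (0 : ℝ) < S.card := by exact_mod_cast hS
  have : S.card * (expGain P ℓ g) ≤ S.card * (expGain P ℓ f + 2 * ε) := by linarith
  exact le_of_mul_le_mul_left this hS'

end

/-! ### Values of the oracle and of the algorithm -/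

namespace Economy

variable (E : Economy) {T s : ℕ} (G : ℕ → ℝ)

theorem vDiscard_eq (t : ℕ) : E.vDiscard t = -(E.c * E.n * t) := by
  simp [vDiscard, preCost, mul_comm]

theorem vSwitch_eq {t : ℕ} (ht : t ≤ T) :
    E.vSwitch T G t = -(E.c * E.n * T) - E.cs + E.n * ((T - t) * G t) := by
  simp only [vSwitch, preCost, postCost, sum_const, Nat.card_Icc, Nat.card_Ioc, nsmul_eq_mul,
    Nat.add_sub_cancel, Nat.cast_sub ht]
  ring

theorem algValue_eq (hs : s ∈ Icc 1 T) (a : Decision) :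
    E.algValue T G s a = match a with
      | .switch => E.vSwitch T G s
      | .discard => E.vDiscard s := by
  obtain ⟨h1, h2⟩ := mem_Icc.1 hs
  have hsplit : ∑ t ∈ Icc 1 T, E.stepValue G s a t =
      ∑ t ∈ Icc 1 s, E.stepValue G s a t + ∑ t ∈ Ioc s T, E.stepValue G s a t := by
    rw [← sum_union]
    · congr 1
      ext t
      simp only [mem_Icc, mem_union, mem_Ioc]
      omega
    · refine disjoint_left.2 fun t ht ht' => ?_
      simp only [mem_Icc, mem_Ioc] at ht ht'
      omega
  have hpre : ∀ x : ℝ, ∑ t ∈ Icc 1 s, (-E.preCost - if t = s then x else 0) =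
      -(∑ _t ∈ Icc 1 s, E.preCost) - x := by
    intro x
    rw [sum_sub_distrib, sum_neg_distrib, sum_ite_eq', if_pos (mem_Icc.2 ⟨h1, le_rfl⟩)]
  rw [algValue, hsplit]
  cases a
  · simp only [vSwitch]
    rw [← hpre]
    refine congrArg₂ _ (sum_congr rfl fun t ht => ?_) (sum_congr rfl fun t ht => ?_)
    · have := (mem_Icc.1 ht).2
      rcases this.lt_or_eq with h | h
      · simp [stepValue, h, h.ne]
      · simp [stepValue, h]
    · have := (mem_Ioc.1 ht).1
      simp [stepValue, this.not_gt, this.ne']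
  · have h0 := hpre 0
    simp only [ite_self, sub_zero] at h0
    simp only [vDiscard]
    rw [← h0, add_eq_left.2]
    · refine sum_congr rfl fun t ht => ?_
      have := (mem_Icc.1 ht).2
      rcases this.lt_or_eq with h | h <;> simp [stepValue, h]
    · refine sum_eq_zero fun t ht => ?_
      have := (mem_Ioc.1 ht).1
      simp [stepValue, this.not_gt, this.ne']

theorem oracleValue_le {v : ℝ} (hv : 0 ≤ v) (h : ∀ t ∈ Icc 1 T, E.vSwitch T G t ≤ v) :
    E.oracleValue T G ≤ v :=
  (fold_max_le v).2 ⟨hv, h⟩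

theorem oracleValue_nonneg : 0 ≤ E.oracleValue T G :=
  (le_fold_max 0).2 (Or.inl le_rfl)

theorem vSwitch_le_oracleValue {t : ℕ} (ht : t ∈ Icc 1 T) :
    E.vSwitch T G t ≤ E.oracleValue T G :=
  (le_fold_max _).2 (Or.inr ⟨t, ht, le_rfl⟩)

theorem algValue_le_oracleValue (hs : s ∈ Icc 1 T) (a : Decision) :
    E.algValue T G s a ≤ E.oracleValue T G := by
  rw [algValue_eq E G hs]
  cases a
  · exact E.vSwitch_le_oracleValue G hs
  · refine le_trans ?_ (E.oracleValue_nonneg G)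
    rw [vDiscard_eq, neg_nonpos]
    have := E.c_nonneg
    positivity

/-- The value loss is at most linear in the horizon. -/
theorem oracleValue_sub_algValue_le (hG : ∀ t, |G t| ≤ 2) (hs : s ∈ Icc 1 T) (a : Decision) :
    E.oracleValue T G - E.algValue T G s a ≤ (4 * E.n + E.c * E.n + E.cs) * T := by
  obtain ⟨h1, h2⟩ := mem_Icc.1 hs
  have hc := E.c_nonneg
  have hcs := E.cs_pos
  have hn : (0 : ℝ) ≤ E.n := Nat.cast_nonneg _
  have hT : (1 : ℝ) ≤ T := by exact_mod_cast h1.trans h2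
  have hcsT : E.cs ≤ E.cs * T := le_mul_of_one_le_right hcs.le hT
  have hcn : 0 ≤ E.c * E.n * T := by positivity
  have hb : ∀ t ∈ Icc 1 T, |((T : ℝ) - t) * G t| ≤ T * 2 := by
    intro t ht
    have : (t : ℝ) ≤ T := by exact_mod_cast (mem_Icc.1 ht).2
    rw [abs_mul, abs_of_nonneg (sub_nonneg.2 this)]
    refine mul_le_mul ?_ (hG t) (abs_nonneg _) (by linarith)
    linarith [(Nat.cast_nonneg t : (0 : ℝ) ≤ t)]
  have horacle : E.oracleValue T G ≤ E.n * (T * 2) := by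
    refine E.oracleValue_le G (by positivity) fun t ht => ?_
    rw [vSwitch_eq E G (mem_Icc.1 ht).2]
    have := mul_le_mul_of_nonneg_left (abs_le.1 (hb t ht)).2 hn
    linarith
  have halg : -(E.c * E.n * T) - E.cs - E.n * (T * 2) ≤ E.algValue T G s a := by
    rw [algValue_eq E G hs]
    cases a
    · simp only [vSwitch_eq E G h2]
      have := mul_le_mul_of_nonneg_left (abs_le.1 (hb s hs)).1 hn
      linarith
    · simp only [vDiscard_eq]
      have : (s : ℝ) ≤ T := by exact_mod_cast h2
      have h3 := mul_le_mul_of_nonneg_left this (mul_nonneg hc hn)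
      have : 0 ≤ E.n * ((T : ℝ) * 2) := by positivity
      linarith
  linarith

/-- If no challenger beats the one at the decision time by more than `η`, and the decision agrees
with the sign of the incremental value up to `κ`, the value loss is at most `κ`, plus `η` for each
of the `n T` samples, plus a term linear in the decision time. -/
theorem oracleValue_sub_algValue_le_of_rule (hs : s ∈ Icc 1 T) {a : Decision} {η κ : ℝ}
    (hGs : |G s| ≤ 2) (hη : 0 ≤ η) (hκ : 0 ≤ κ) (hGη : ∀ t ∈ Icc 1 T, G t ≤ G s + η)
    (hdis : E.deltaV T G s + κ < 0 → a = .discard)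
    (hsw : 0 < E.deltaV T G s - κ → a = .switch) :
    E.oracleValue T G - E.algValue T G s a ≤ κ + E.n * (T * η) + (E.c + 2) * E.n * s := by
  obtain ⟨h1, h2⟩ := mem_Icc.1 hs
  have hc := E.c_nonneg
  have hcs := E.cs_pos
  have hn : (0 : ℝ) ≤ E.n := Nat.cast_nonneg _
  have hT : (0 : ℝ) ≤ T := Nat.cast_nonneg _
  have hsT : (s : ℝ) ≤ T := by exact_mod_cast h2
  have hs0 : (0 : ℝ) ≤ s := Nat.cast_nonneg _
  have hΔ : E.deltaV T G s = E.vSwitch T G s + E.c * E.n * s := by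
    rw [deltaV, vDiscard_eq, sub_neg_eq_add]
  have hnT : 0 ≤ E.n * (T * η) := by positivity
  have hns : 0 ≤ E.c * E.n * s := by positivity
  have hns' : (0 : ℝ) ≤ E.n * s := by positivity
  have hGs' : E.n * (s * G s) ≤ 2 * E.n * s := by
    have := mul_le_mul_of_nonneg_left (abs_le.1 hGs).2 hns'
    linarith
  have horacle : E.oracleValue T G ≤
      max 0 (E.deltaV T G s) + E.n * (T * η) + 2 * E.n * s := by
    refine E.oracleValue_le G ?_ fun t ht => ?_
    · have := le_max_left 0 (E.deltaV T G s)
      linarith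
    · have htT : (t : ℝ) ≤ T := by exact_mod_cast (mem_Icc.1 ht).2
      have ht0 : (0 : ℝ) ≤ t := Nat.cast_nonneg _
      rw [vSwitch_eq E G (mem_Icc.1 ht).2]
      have h3 : ((T : ℝ) - t) * G t ≤ (T - t) * (G s + η) :=
        mul_le_mul_of_nonneg_left (hGη t ht) (by linarith)
      have hcT : 0 ≤ E.c * E.n * T := by positivity
      rcases le_total 0 (G s + η) with h | h
      · have h4 : ((T : ℝ) - t) * (G s + η) ≤ T * (G s + η) :=
          mul_le_mul_of_nonneg_right (by linarith) h
        have h5 := mul_le_mul_of_nonneg_left (h3.trans h4) hn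
        have h6 := le_max_right 0 (E.deltaV T G s)
        rw [hΔ, vSwitch_eq E G h2] at h6
        rw [hΔ, vSwitch_eq E G h2]
        linarith
      · have h4 : ((T : ℝ) - t) * (G s + η) ≤ 0 :=
          mul_nonpos_of_nonneg_of_nonpos (by linarith) h
        have h5 := mul_le_mul_of_nonneg_left (h3.trans h4) hn
        have h6 := le_max_left 0 (E.deltaV T G s)
        linarith
  have halg : max 0 (E.deltaV T G s) - κ - E.c * E.n * s ≤ E.algValue T G s a := by
    rw [algValue_eq E G hs]
    cases a
    · have h : 0 ≤ E.deltaV T G s + κ := by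
        by_contra! h
        cases hdis h
      have : max 0 (E.deltaV T G s) ≤ E.deltaV T G s + κ := max_le h (by linarith)
      simp only
      linarith
    · have h : E.deltaV T G s - κ ≤ 0 := by
        by_contra! h
        cases hsw h
      have : max 0 (E.deltaV T G s) ≤ κ := max_le hκ (by linarith)
      simp only [vDiscard_eq]
      linarith
  linarith

end Economy

section

variable {Ω : Type*} [MeasurableSpace Ω] {E : Economy} {G : ℕ → Ω → ℝ} {A : Algorithm Ω}

theorem valueLoss_zero (ω : Ω) : valueLoss E G A 0 ω = 0 := by
  simp [valueLoss, Economy.oracleValue, Economy.algValue]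

theorem measurable_fold_max {α : Type*} (s : Finset α) {g : α → Ω → ℝ}
    (hg : ∀ a, Measurable (g a)) : Measurable fun ω => s.fold max 0 fun a => g a ω := by
  classical
  induction s using Finset.induction_on with
  | empty => simp
  | insert a s ha ih =>
    simp only [fold_insert ha]
    exact (hg a).max ih

theorem measurable_apply_of_countable {h : ℕ → Ω → ℝ} (hh : ∀ t, Measurable (h t)) {τ : Ω → ℕ}
    (hτ : Measurable τ) : Measurable fun ω => h (τ ω) ω :=
  (measurable_from_prod_countable_right (f := fun p : ℕ × Ω => h p.1 p.2) hh).comp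
    (hτ.prodMk measurable_id)

theorem measurable_vSwitch (hG : ∀ t, Measurable (G t)) (T t : ℕ) :
    Measurable fun ω => E.vSwitch T (fun t => G t ω) t := by
  have := hG t
  unfold Economy.vSwitch
  fun_prop

theorem measurable_algValue (hG : ∀ t, Measurable (G t)) {T : ℕ} (hT : 1 ≤ T) :
    Measurable fun ω => E.algValue T (fun t => G t ω) (A.time T ω) (A.decision T ω) := by
  classical
  have hsw : Measurable fun ω => E.vSwitch T (fun t => G t ω) (A.time T ω) :=
    measurable_apply_of_countable (h := fun t ω => E.vSwitch T (fun t => G t ω) t)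
      (measurable_vSwitch hG T) (A.measurable_time T)
  have hdis : Measurable fun ω => E.vDiscard (A.time T ω) :=
    (measurable_of_countable E.vDiscard).comp (A.measurable_time T)
  have heq : (fun ω => E.algValue T (fun t => G t ω) (A.time T ω) (A.decision T ω)) =
      fun ω => if A.decision T ω = Decision.switch then
        E.vSwitch T (fun t => G t ω) (A.time T ω) else E.vDiscard (A.time T ω) := by
    funext ω
    rw [E.algValue_eq _ (A.time_mem T hT ω)]
    cases h : A.decision T ω <;> simp
  rw [heq]
  exact Measurable.ite (A.measurableSet_switch T) hsw hdis

theorem measurable_oracleValue (hG : ∀ t, Measurable (G t)) (T : ℕ) :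
    Measurable fun ω => E.oracleValue T (fun t => G t ω) := by
  exact measurable_fold_max (Icc 1 T) (measurable_vSwitch hG T)

theorem measurable_valueLoss (hG : ∀ t, Measurable (G t)) (T : ℕ) :
    Measurable (valueLoss E G A T) := by
  rcases T.eq_zero_or_pos with h | hT
  · subst h
    simp only [funext valueLoss_zero, measurable_const]
  · exact (measurable_oracleValue hG T).sub (measurable_algValue hG hT)

theorem aemeasurable_valueLoss {μ : Measure Ω} (hG : ∀ t, AEMeasurable (G t) μ) (T : ℕ) :
    AEMeasurable (valueLoss E G A T) μ := by
  refine ⟨valueLoss E (fun t => (hG t).mk (G t)) A T,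
    measurable_valueLoss (fun t => (hG t).measurable_mk) T, ?_⟩
  filter_upwards [ae_all_iff.2 fun t => (hG t).ae_eq_mk] with ω h
  simp only [valueLoss, h]

theorem valueLoss_nonneg (T : ℕ) (ω : Ω) : 0 ≤ valueLoss E G A T ω := by
  rcases T.eq_zero_or_pos with rfl | hT
  · exact (valueLoss_zero ω).ge
  · exact sub_nonneg.2 (E.algValue_le_oracleValue _ (A.time_mem T hT ω) _)

theorem valueLoss_le (hG : ∀ t ω, |G t ω| ≤ 2) (T : ℕ) (ω : Ω) :
    valueLoss E G A T ω ≤ (4 * E.n + E.c * E.n + E.cs) * T := by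
  rcases T.eq_zero_or_pos with rfl | hT
  · simp [valueLoss_zero]
  · exact E.oracleValue_sub_algValue_le _ (fun t => hG t ω) (A.time_mem T hT ω) _

theorem integrable_valueLoss {μ : Measure Ω} [IsFiniteMeasure μ]
    (hGm : ∀ t, AEMeasurable (G t) μ) (hG : ∀ t ω, |G t ω| ≤ 2) (T : ℕ) :
    Integrable (valueLoss E G A T) μ := by
  refine Integrable.of_bound (aemeasurable_valueLoss hGm T).aestronglyMeasurable
    ((4 * E.n + E.c * E.n + E.cs) * T) (Eventually.of_forall fun ω => ?_)
  rw [Real.norm_eq_abs, abs_of_nonneg (valueLoss_nonneg T ω)]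
  exact valueLoss_le hG T ω

end

theorem abs_perfGap_le {X XI : Type*} [MeasurableSpace X] (P : Measure (X × Bool))
    [IsProbabilityMeasure P] {ℓ : Bool → Bool → ℝ} (hℓ : ∀ a b, ℓ a b = -1 ∨ ℓ a b = 1)
    (proj : X → XI) (fI : XI → Bool) (f : X → Bool) : |perfGap P ℓ proj fI f| ≤ 2 := by
  have h : ∀ g : X → Bool, |∫ z, ℓ (g z.1) z.2 ∂P| ≤ 1 := by
    intro g
    simpa using norm_integral_le_of_norm_le_const (μ := P) (C := 1)
      (f := fun z : X × Bool => ℓ (g z.1) z.2)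
      (Eventually.of_forall fun z => (abs_gain_eq_one hℓ _ _).le)
  refine (abs_sub _ _).trans ?_
  linarith [h f, h fun x => fI (proj x)]

/-- A nonnegative function bounded by `M`, and by `b` with probability at least `1 - δ`, has
integral at most `b + M δ`. -/
theorem integral_le_of_prob {Ω : Type*} [MeasurableSpace Ω] {μ : Measure Ω}
    [IsProbabilityMeasure μ] {g : Ω → ℝ} (hg : Integrable g μ) {b M δ : ℝ} (hb : 0 ≤ b)
    (hM : 0 ≤ M) (hgM : ∀ ω, g ω ≤ M) (hδ : 1 - δ ≤ μ.real {ω | g ω ≤ b}) :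
    ∫ ω, g ω ∂μ ≤ b + M * δ := by
  have hnull : NullMeasurableSet {ω | g ω ≤ b} μ :=
    nullMeasurableSet_le hg.aemeasurable aemeasurable_const
  let U := toMeasurable μ {ω | g ω ≤ b}ᶜ
  have hU : MeasurableSet U := measurableSet_toMeasurable _ _
  have hUδ : μ.real U ≤ δ := by
    have h1 : μ.real U = μ.real {ω | g ω ≤ b}ᶜ := by
      simp only [measureReal_def, U, measure_toMeasurable]
    have h2 := probReal_compl_eq_one_sub₀ hnull
    linarith
  calc ∫ ω, g ω ∂μ ≤ ∫ ω, (b + U.indicator (fun _ => M) ω) ∂μ := by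
        refine integral_mono hg
          ((integrable_const b).add ((integrable_const M).indicator hU)) fun ω => ?_
        by_cases h : ω ∈ U
        · simp only [Set.indicator_of_mem h]
          linarith [hgM ω]
        · have : g ω ≤ b := by
            by_contra h'
            exact h (subset_toMeasurable _ _ h')
          simpa [Set.indicator_of_notMem h] using this
    _ = b + M * μ.real U := by
        rw [integral_add (integrable_const b) ((integrable_const M).indicator hU),
          integral_indicator_const _ hU]
        simp [mul_comm]
    _ ≤ b + M * δ := by gcongr

/-! ### Rates -/

theorem vc_tail_le {T N d : ℕ} (hT : 1 ≤ T) (hN : 2 * N + 1 ≤ T ^ 2) :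
    2 * (2 * N + 1 : ℝ) ^ d * Real.exp (-((2 * d + 2 : ℕ) * Real.log T)) ≤ 2 / (T : ℝ) ^ 2 := by
  have hT' : (0 : ℝ) < T := by exact_mod_cast hT
  have hN' : (2 * N + 1 : ℝ) ≤ (T : ℝ) ^ 2 := by exact_mod_cast hN
  have h1 : (2 * N + 1 : ℝ) ^ d ≤ (T : ℝ) ^ (2 * d) := by
    rw [pow_mul]
    gcongr
  have h2 : Real.exp (-((2 * d + 2 : ℕ) * Real.log T)) = ((T : ℝ) ^ (2 * d + 2))⁻¹ := by
    rw [Real.exp_neg, Real.exp_nat_mul, Real.exp_log hT']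
  rw [h2, ← div_eq_mul_inv, div_le_div_iff₀ (by positivity) (by positivity), pow_add]
  have : (0 : ℝ) ≤ (T : ℝ) ^ 2 := by positivity
  nlinarith [mul_le_mul_of_nonneg_right h1 this]

/-- The deviation level `K T^{-1/3} √(log T)` balances the size of a sample of order `T^{2/3}`. -/
theorem rate_exponent_eq {T : ℕ} (hT : 1 ≤ T) (a K : ℝ) :
    a * (T : ℝ) ^ (2 / 3 : ℝ) * (K * rate T / T) ^ 2 = a * K ^ 2 * Real.log T := by
  have hT' : (0 : ℝ) < T := by exact_mod_cast hT
  have hq : ((T : ℝ) ^ (2 / 3 : ℝ)) ^ 3 = (T : ℝ) ^ 2 := by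
    rw [← Real.rpow_natCast, ← Real.rpow_mul hT'.le]
    norm_num
  have hl : √(Real.log T) ^ 2 = Real.log T := Real.sq_sqrt (Real.log_natCast_nonneg T)
  rw [rate]
  field_simp
  calc _ = a * K ^ 2 * (((T : ℝ) ^ (2 / 3 : ℝ)) ^ 3 * √(Real.log T) ^ 2) := by ring
    _ = _ := by rw [hq, hl]; ring

theorem one_le_sqrt_log {T : ℕ} (hT : 3 ≤ T) : 1 ≤ √(Real.log T) := by
  rw [Real.one_le_sqrt, Real.le_log_iff_exp_le (by positivity)]
  have : (3 : ℝ) ≤ T := by exact_mod_cast hT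
  linarith [Real.exp_one_lt_d9]

theorem rpow_le_rate {T : ℕ} (hT : 3 ≤ T) : (T : ℝ) ^ (2 / 3 : ℝ) ≤ rate T :=
  le_mul_of_one_le_right (by positivity) (one_le_sqrt_log hT)

end ModelSwitch

open ModelSwitch in
theorem theorem2
    {Ω X XI : Type*} [MeasurableSpace Ω] [MeasurableSpace X] [MeasurableSpace XI]
    (μ : Measure Ω) [IsProbabilityMeasure μ]
    (P : Measure (X × Bool)) [IsProbabilityMeasure P]
    (E : ModelSwitch.Economy)
    (ℓ : Bool → Bool → ℝ) (hℓ : ∀ a b, ℓ a b = -1 ∨ ℓ a b = 1)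
    (proj : X → XI) (hproj : Measurable proj) (fI : XI → Bool) (hfI : Measurable fI)
    (F : Set (X → Bool)) (hF : ModelSwitch.IsMeasurableClass P ℓ F)
    (d : ℕ) (hd : ModelSwitch.vcDim F = d)
    (Z : ℕ → Ω → X × Bool) (hZm : ∀ i, Measurable (Z i)) (hZi : iIndepFun Z μ)
    (hZP : ∀ i, μ.map (Z i) = P)
    (ρ : ℝ) (hρ : ρ ∈ Set.Ioo (0 : ℝ) 1)
    (S : ℕ → Ω → Finset ℕ) (hS : ModelSwitch.IsRandomSplit μ E ρ Z S)
    (f : ℕ → Ω → X → Bool) (hf : ModelSwitch.IsERM ℓ F Z S f)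
    (G : ℕ → Ω → ℝ) (hG : ∀ t ω, G t ω = ModelSwitch.perfGap P ℓ proj fI (f t ω))
    (hGm : ∀ t, AEMeasurable (G t) μ)
    (A : ModelSwitch.Algorithm Ω)
    (w₁ w₂ w₃ w₄ : ℝ) (hw₁ : 0 < w₁) (hw₂ : 0 < w₂) (hw₃ : 0 < w₃) (hw₄ : 0 < w₄)
    (hC : ∀ᶠ T : ℕ in atTop,
      1 - w₁ / T ≤ μ.real {ω | ModelSwitch.CondStop A w₂ w₃ T ω ∧
        ModelSwitch.CondRule E G A w₄ T ω}) :
    (∀ T, Integrable (ModelSwitch.valueLoss E G A T) μ) ∧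
      (fun T : ℕ => ModelSwitch.regret μ E G A T) =O[atTop]
        fun T : ℕ => (T : ℝ) ^ (2 / 3 : ℝ) * √(Real.log T) := by
  have hGb : ∀ t ω, |G t ω| ≤ 2 := fun t ω => by
    rw [hG]
    exact abs_perfGap_le P hℓ proj fI (f t ω)
  have hint : ∀ T, Integrable (valueLoss E G A T) μ := integrable_valueLoss hGm hGb
  refine ⟨hint, ?_⟩
  obtain ⟨ω₀⟩ : Nonempty Ω := nonempty_of_isProbabilityMeasure μ
  have hne : F.Nonempty := ⟨f 0 ω₀, (hf 0 ω₀).1⟩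
  have hρ' : 0 < 1 - ρ := sub_pos.2 hρ.2
  have hn : (1 : ℝ) ≤ E.n := by exact_mod_cast E.n_pos
  have hc := E.c_nonneg
  have hcs := E.cs_pos
  -- For `t > w₂ T^{2/3}`, the training set at time `t` has at least `a T^{2/3}` points.
  set a := (1 - ρ) * w₂ / 2 with ha
  have ha0 : 0 < a := by positivity
  -- `K` makes the deviation probability at a single time step at most `2 / T ^ 2`.
  set K := √(8 * (2 * d + 2) / a) with hK
  have hK0 : 0 ≤ K := Real.sqrt_nonneg _
  have haK : a * K ^ 2 = 8 * (2 * d + 2) := by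
    rw [hK, Real.sq_sqrt (by positivity)]
    field_simp
  set M := 4 * E.n + E.c * E.n + E.cs with hM
  have hM0 : 0 ≤ M := by positivity
  set B := w₄ + 2 * E.n * K + (E.c + 2) * E.n * w₃ with hB
  have hB0 : 0 ≤ B := by positivity
  have hlarge : ∀ᶠ T : ℕ in atTop, 1 ≤ a * (T : ℝ) ^ (2 / 3 : ℝ) :=
    (((tendsto_rpow_atTop (by norm_num : (0 : ℝ) < 2 / 3)).comp
      tendsto_natCast_atTop_atTop).const_mul_atTop ha0).eventually_ge_atTop 1
  refine IsBigO.of_bound (B + M * (w₁ + 2)) ?_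
  filter_upwards [hC, hlarge, eventually_ge_atTop 3, eventually_ge_atTop (2 * E.n + 1)]
    with T hCT haq hT3 hTn
  have hT1 : 1 ≤ T := by omega
  have hT0 : (0 : ℝ) < T := by exact_mod_cast hT1
  have hq := rpow_le_rate hT3
  set q := (T : ℝ) ^ (2 / 3 : ℝ) with hq_def
  have hq1 : 1 ≤ q := Real.one_le_rpow (by exact_mod_cast hT1) (by norm_num)
  change ‖regret μ E G A T‖ ≤ (B + M * (w₁ + 2)) * ‖rate T‖
  have hr1 : 1 ≤ rate T := hq1.trans hq
  set ε := K * rate T / T with hε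
  have hε0 : 0 ≤ ε := by positivity
  let D : ℕ → Set Ω := fun t => {ω | ∃ g ∈ F, (S t ω).card * ε ≤
    |∑ i ∈ S t ω, ℓ (g (Z i ω).1) (Z i ω).2 - (S t ω).card * expGain P ℓ g|}
  let J : Finset ℕ := {t ∈ Icc 1 T | w₂ * q < t}
  have hcard : ∀ t ∈ J, ∀ ω, a * q ≤ (S t ω).card := by
    intro t ht ω
    have h1 := (abs_lt.1 (hS.card t ω)).1
    have h2 : w₂ * q < t := (mem_filter.1 ht).2
    have h3 : (t : ℝ) ≤ E.N t := by
      rw [Economy.N, Nat.cast_mul]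
      exact le_mul_of_one_le_left (Nat.cast_nonneg t) hn
    have h4 := mul_le_mul_of_nonneg_left (h2.le.trans h3) hρ'.le
    have h5 : (1 - ρ) * (w₂ * q) = 2 * (a * q) := by rw [ha]; ring
    linarith
  have hD : ∀ t ∈ J, μ.real (D t) ≤ 2 / (T : ℝ) ^ 2 := by
    intro t ht
    have htT : t ≤ T := (mem_Icc.1 (mem_filter.1 ht).1).2
    have hN : 2 * E.N t + 1 ≤ T ^ 2 := by
      have : E.n * t ≤ E.n * T := Nat.mul_le_mul_left _ htT
      rw [Economy.N]
      nlinarith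
    have h := measure_exists_deviation_le hF hℓ hne hd hZm hZi hZP (hS.measurable t)
      (hS.indep t) (hS.subset t) (hcard t ht) hε0
    have hexp : a * q * ε ^ 2 / 8 = (2 * d + 2 : ℕ) * Real.log T := by
      rw [hε, hq_def, rate_exponent_eq hT1, haK]
      push_cast
      ring
    rw [hexp] at h
    exact ENNReal.toReal_le_of_le_ofReal (by positivity)
      (h.trans (ENNReal.ofReal_le_ofReal (vc_tail_le hT1 hN)))
  have hbad : μ.real (⋃ t ∈ J, D t) ≤ 2 / T := by
    calc μ.real (⋃ t ∈ J, D t) ≤ ∑ t ∈ J, μ.real (D t) := measureReal_biUnion_finset_le _ _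
      _ ≤ ∑ _t ∈ J, 2 / (T : ℝ) ^ 2 := sum_le_sum hD
      _ ≤ ∑ _t ∈ Icc 1 T, 2 / (T : ℝ) ^ 2 :=
        sum_le_sum_of_subset_of_nonneg (filter_subset _ _) fun _ _ _ => by positivity
      _ = 2 / T := by
        rw [sum_const, Nat.card_Icc, Nat.add_sub_cancel, nsmul_eq_mul]
        field_simp
  have hgood : {ω | CondStop A w₂ w₃ T ω ∧ CondRule E G A w₄ T ω} ⊆
      {ω | valueLoss E G A T ω ≤ B * rate T} ∪ ⋃ t ∈ J, D t := by
    rintro ω ⟨⟨hlo, hhi⟩, hdis, hsw⟩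
    by_cases hω : ω ∈ ⋃ t ∈ J, D t
    · exact Or.inr hω
    refine Or.inl ?_
    have hs := A.time_mem T hT1 ω
    set s := A.time T ω
    have hsJ : s ∈ J := mem_filter.2 ⟨hs, hlo⟩
    have hωs : ∀ g ∈ F, |∑ i ∈ S s ω, ℓ (g (Z i ω).1) (Z i ω).2 -
        (S s ω).card * expGain P ℓ g| < (S s ω).card * ε := by
      intro g hg
      by_contra! h
      exact hω (Set.mem_biUnion (mem_coe.2 hsJ) ⟨g, hg, h⟩)
    have hpos : 0 < (S s ω).card := by
      have := haq.trans (hcard s hsJ ω)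
      exact_mod_cast one_pos.trans_le this
    have hGη : ∀ t ∈ Icc 1 T, G t ω ≤ G s ω + 2 * ε := by
      intro t _
      have := expGain_le_of_erm (z := fun i => Z i ω) hpos hωs (hf s ω).1 (hf t ω).1
        ((hf s ω).2 _ (hf t ω).1)
      rw [hG, hG, perfGap, perfGap]
      unfold expGain at this
      linarith
    have hloss := E.oracleValue_sub_algValue_le_of_rule (fun t => G t ω) hs
      (hGb s ω) (by positivity) (by positivity : 0 ≤ w₄ * rate T) hGη hdis hsw
    have hTε : (T : ℝ) * (2 * ε) = 2 * K * rate T := by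
      rw [hε]
      field_simp
    rw [hTε] at hloss
    have hs' : (E.c + 2) * E.n * (s : ℝ) ≤ (E.c + 2) * E.n * (w₃ * rate T) :=
      mul_le_mul_of_nonneg_left
        (hhi.le.trans (mul_le_mul_of_nonneg_left hq hw₃.le)) (by positivity)
    refine hloss.trans ?_
    rw [hB]
    linarith
  have hprob : 1 - (w₁ + 2) / T ≤ μ.real {ω | valueLoss E G A T ω ≤ B * rate T} := by
    have h1 := (measureReal_mono (μ := μ) hgood).trans (measureReal_union_le _ _)
    rw [add_div]
    linarith
  have hreg : regret μ E G A T ≤ B * rate T + M * T * ((w₁ + 2) / T) :=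
    integral_le_of_prob (hint T) (by positivity) (by positivity) (valueLoss_le hGb T) hprob
  have hMT : M * T * ((w₁ + 2) / T) = M * (w₁ + 2) := by field_simp
  have hreg0 : 0 ≤ regret μ E G A T := integral_nonneg (valueLoss_nonneg T)
  rw [Real.norm_eq_abs, Real.norm_eq_abs, abs_of_nonneg hreg0,
    abs_of_nonneg (zero_le_one.trans hr1)]
  refine hreg.trans ?_
  rw [hMT, add_mul]
  have := le_mul_of_one_le_right (by positivity : 0 ≤ M * (w₁ + 2)) hr1
  linarith
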